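/- Let $\mathscr{H}$ be a complex Hilbert space and let $T$ be a bounded linear operator on $\mathscr{H}$, with adjoint $T^*$ and numerical radius $w(T)=\sup\{|\langle Tx,x\rangle| : x\in\mathscr{H},\ \|x\|=1\}$ (equal to $0$ if $\mathscr{H}=\{0\}$). Then, for every real number $r$ with $1\le r\le 2$, $$w^2(T)\ \le\ \left\|\int_0^1\big(tT^*T+(1-t)TT^*\big)^r\,dt\right\|^{1/r}\ \le\ \left\|\frac{(T^*T)^r+(TT^*)^r}{2}\right\|^{1/r}.$$ Here $\|\cdot\|$ is the operator norm, the powers of positive operators are those of the continuous functional calculus, and the integral is the Bochner integral of an operator-valued function, which is Bochner integrable on $[0,1]$ with respect to the operator norm. -/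

import Mathlib

/-- The numerical radius `w(T) = sup {|⟨T x, x⟩| : ‖x‖ = 1}` of a bounded operator.
The set is bounded above (see `bddAbove_numericalRange_norm`); on the zero space it is
empty and `w(T) = 0`. Mathlib's inner product is conjugate-linear in its first slot, so the
usual `⟨T x, x⟩` (linear in the first slot) is written `inner ℂ x (T x)`. -/
noncomputable def numericalRadius {H : Type*} [NormedAddCommGroup H] [InnerProductSpace ℂ H]
    (T : H →L[ℂ] H) : ℝ :=
  sSup {a : ℝ | ∃ x : H, ‖x‖ = 1 ∧ a = ‖inner ℂ x (T x)‖}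

theorem bddAbove_numericalRange_norm {H : Type*} [NormedAddCommGroup H]
    [InnerProductSpace ℂ H] (T : H →L[ℂ] H) :
    BddAbove {a : ℝ | ∃ x : H, ‖x‖ = 1 ∧ a = ‖inner ℂ x (T x)‖} := by
  refine ⟨‖T‖, ?_⟩
  rintro a ⟨x, hx, rfl⟩
  calc ‖inner ℂ x (T x)‖ ≤ ‖x‖ * ‖T x‖ := norm_inner_le_norm x (T x)
    _ ≤ ‖T‖ := by
      have := T.le_opNorm x
      rw [hx, mul_one] at this
      rwa [hx, one_mul]

/-! Put `a = T*T`, `b = TT*`. For a unit vector x and c = |⟨Tx, x⟩|², Cauchy–Schwarz gives c ≤ ⟨(a +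
b)/2 x, x⟩. By functional calculus, each operator on the segment from b to a satisfies the scalar
tangent inequality for y ↦ y^r at c. The tangent is affine, so integrating it leaves only the
midpoint (a + b)/2, and evaluating at x bounds the norm of the integral below by c^r. The second
inequality integrates the operator convexity of the r-th power, then uses monotonicity of the norm
on positive operators. -/

section OperatorConvexity

variable {A : Type*} [CStarAlgebra A] [PartialOrder A] [StarOrderedRing A]

/-- On positive x the integrand is a positive multiple of t⁻¹x + t(t + x)⁻¹ - 1, so convexity
reduces to that of the operator inverse. -/
lemma CFC.convexOn_cfc_rpowIntegrand₁₂ {p t : ℝ} (ht : 0 < t) :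
    ConvexOn ℝ (Set.Ici (0 : A)) (cfc (Real.rpowIntegrand₁₂ p t)) := by
  have heq : (Set.Ici (0 : A)).EqOn (cfc (Real.rpowIntegrand₁₂ p t))
      (fun x : A => t ^ (p - 1) •
        (t⁻¹ • x + t • Ring.inverse (algebraMap ℝ A t + x) - algebraMap ℝ A 1)) := by
    intro x hx
    have hx' : 0 ≤ x := hx
    have hspec : ∀ y ∈ spectrum ℝ x, 0 ≤ y := fun y hy => spectrum_nonneg_of_nonneg hx' hy
    have hne : ∀ y ∈ spectrum ℝ x, t + y ≠ 0 := fun y hy => by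
      have := hspec y hy
      positivity
    have hinv : ContinuousOn (fun y : ℝ => (t + y)⁻¹) (spectrum ℝ x) :=
      ContinuousOn.inv₀ (by fun_prop) hne
    have hinv' : ContinuousOn (fun y : ℝ => t * (t + y)⁻¹) (spectrum ℝ x) :=
      continuousOn_const.mul hinv
    have hlin : ContinuousOn (fun y : ℝ => t⁻¹ * y) (spectrum ℝ x) := by fun_prop
    have hsum : ContinuousOn (fun y : ℝ => t⁻¹ * y + t * (t + y)⁻¹) (spectrum ℝ x) :=
      hlin.add hinv'
    unfold Real.rpowIntegrand₁₂
    rw [cfc_const_mul (t ^ (p - 1)) (fun y : ℝ => t⁻¹ * y + t * (t + y)⁻¹ - 1) x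
        (hsum.sub continuousOn_const),
      cfc_sub (fun y : ℝ => t⁻¹ * y + t * (t + y)⁻¹) (fun _ => 1) x hsum continuousOn_const,
      cfc_add x (fun y : ℝ => t⁻¹ * y) (fun y : ℝ => t * (t + y)⁻¹) hlin hinv',
      cfc_const_mul t⁻¹ (fun y : ℝ => y) x continuousOn_id,
      cfc_const_mul t (fun y : ℝ => (t + y)⁻¹) x hinv, cfc_const .., cfc_id' ..,
      cfc_inv (fun y : ℝ => t + y) x hne (by fun_prop), cfc_const_add .., cfc_id' ..]
  refine ConvexOn.congr ?_ heq.symm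
  refine ConvexOn.smul (by positivity) ?_
  refine ConvexOn.sub ?_ (concaveOn_const _ (convex_Ici 0))
  refine ConvexOn.add ?_ ?_
  · exact ((convexOn_id (convex_Ici (0 : A))).smul (_root_.inv_nonneg.2 ht.le))
  · exact (CStarAlgebra.convexOn_ringInverse_algebraMap_add ht).smul ht.le

lemma CFC.convexOn_sq : ConvexOn ℝ (Set.Ici (0 : A)) (fun a : A => a ^ 2) := by
  refine ⟨convex_Ici _, fun x hx y hy a b ha hb hab => ?_⟩
  have hx' : IsSelfAdjoint x := IsSelfAdjoint.of_nonneg hx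
  have hy' : IsSelfAdjoint y := IsSelfAdjoint.of_nonneg hy
  have hnonneg : 0 ≤ (a * b) • (star (x - y) * (x - y)) :=
    smul_nonneg (mul_nonneg ha hb) (star_mul_self_nonneg _)
  rw [(hx'.sub hy').star_eq] at hnonneg
  rw [← sub_nonneg]
  -- The convexity defect of the square is exactly ab(x - y)².
  convert hnonneg using 1
  obtain rfl : b = 1 - a := by linarith
  simp only [sq, mul_add, add_mul, mul_sub, sub_mul, smul_mul_assoc, mul_smul_comm]
  module

/-- `a ↦ a ^ p` is operator convex for `p ∈ [1, 2]`. -/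
theorem CFC.convexOn_rpow {p : ℝ} (hp : p ∈ Set.Icc 1 2) :
    ConvexOn ℝ (Set.Ici (0 : A)) (fun a : A => a ^ p) := by
  obtain h1 | h1 := hp.1.eq_or_lt
  · subst h1
    exact (convexOn_id (convex_Ici _)).congr fun a ha => (CFC.rpow_one a ha).symm
  obtain h2 | h2 := hp.2.eq_or_lt
  · subst h2
    exact CFC.convexOn_sq.congr fun a ha => (by exact_mod_cast (CFC.rpow_natCast a 2 ha).symm)
  lift p to NNReal using by linarith
  have hp' : p ∈ Set.Ioo 1 2 := ⟨by exact_mod_cast h1, by exact_mod_cast h2⟩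
  -- For 1 < p < 2 the power is an integral of the convex functions above; the endpoints were
  -- treated separately.
  obtain ⟨μ, hμ⟩ := CFC.exists_measure_nnrpow_eq_integral_cfcₙ_rpowIntegrand₁₂ A hp'
  have heq : (Set.Ici 0).EqOn (fun a : A => a ^ (p : ℝ))
      (fun a : A => ∫ t in Set.Ioi 0, cfcₙ (Real.rpowIntegrand₁₂ p t) a ∂μ) := fun a ha => by
    simp only [← CFC.nnrpow_eq_rpow (zero_lt_one.trans hp'.1)]
    exact (hμ a ha).2
  refine ConvexOn.congr ?_ heq.symm
  refine MeasureTheory.integral_convexOn_of_integrand_ae (convex_Ici _) ?_ fun a ha => (hμ a ha).1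
  filter_upwards [MeasureTheory.ae_restrict_mem measurableSet_Ioi] with t ht
  refine (CFC.convexOn_cfc_rpowIntegrand₁₂ (p := p) ht).congr fun a ha => ?_
  refine (cfcₙ_eq_cfc ?_ (Real.rpowIntegrand₁₂_zero ht)).symm
  refine (Real.continuousOn_rpowIntegrand₁₂_uncurry (p := p) h1 _ subset_rfl).uncurry_left
    t ht |>.mono fun y hy => ?_
  exact quasispectrum_nonneg_of_nonneg a ha y hy

/-- The operator form of the tangent line inequality `c ^ p + p c ^ (p - 1) (y - c) ≤ y ^ p`. -/
lemma CFC.tangent_le_rpow {p c : ℝ} (hp : 1 ≤ p) (hc : 0 ≤ c) {a : A} (ha : 0 ≤ a) :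
    (p * c ^ (p - 1)) • a - algebraMap ℝ A ((p - 1) * c ^ p) ≤ a ^ p := by
  have hcont : ContinuousOn (fun y : ℝ => y ^ p) (spectrum ℝ a) :=
    (Real.continuous_rpow_const (by linarith)).continuousOn
  rw [CFC.rpow_eq_cfc_real ha]
  have heq : (p * c ^ (p - 1)) • a - algebraMap ℝ A ((p - 1) * c ^ p)
      = cfc (fun y : ℝ => (p * c ^ (p - 1)) * y - (p - 1) * c ^ p) a := by
    rw [cfc_sub .., cfc_const_mul .., cfc_const .., cfc_id' ..]
  rw [heq, cfc_le_iff _ _ a]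
  intro y hy
  have hy0 : 0 ≤ y := spectrum_nonneg_of_nonneg ha hy
  -- At c = 0 the slope p * 0 ^ (p - 1) is 1 if p = 1 and 0 otherwise. For c > 0, Bernoulli with s =
  -- y/c - 1, scaled by c ^ p, is the claim.
  obtain rfl | hc := hc.eq_or_lt
  · obtain rfl | hp := hp.eq_or_lt
    · simp
    · simp [Real.zero_rpow (by linarith : p ≠ 0), Real.zero_rpow (by linarith : p - 1 ≠ 0),
        Real.rpow_nonneg hy0]
  have key := one_add_mul_self_le_rpow_one_add (s := y / c - 1)
    (by have : 0 ≤ y / c := by positivity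
        linarith) hp
  rw [add_sub_cancel, Real.div_rpow hy0 hc.le, le_div_iff₀ (by positivity)] at key
  refine le_trans (le_of_eq ?_) key
  rw [Real.rpow_sub_one hc.ne']
  field_simp
  ring

end OperatorConvexity

section Segment

variable {A : Type*} [CStarAlgebra A] [PartialOrder A] [StarOrderedRing A]

lemma segment_nonneg {a b : A} (ha : 0 ≤ a) (hb : 0 ≤ b) {t : ℝ} (ht : t ∈ Set.Icc (0 : ℝ) 1) :
    0 ≤ t • a + (1 - t) • b :=
  add_nonneg (smul_nonneg ht.1 ha) (smul_nonneg (sub_nonneg.2 ht.2) hb)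

lemma CFC.continuousOn_segment_rpow {a b : A} (ha : 0 ≤ a) (hb : 0 ≤ b) {p : ℝ} (hp : 0 ≤ p) :
    ContinuousOn (fun t : ℝ => (t • a + (1 - t) • b) ^ p) (Set.Icc 0 1) :=
  ContinuousOn.cfc_nnreal_of_mem_nhdsSet (s := Set.univ) _ Filter.univ_mem (by fun_prop)
    (fun _ ht => segment_nonneg ha hb ht) (NNReal.continuous_rpow_const hp).continuousOn

omit [PartialOrder A] [StarOrderedRing A] in
lemma intervalIntegral_segment (a b : A) :
    ∫ t in (0 : ℝ)..1, (t • a + (1 - t) • b) = (1 / 2 : ℝ) • (a + b) := by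
  rw [intervalIntegral.integral_add (Continuous.intervalIntegrable (by fun_prop) _ _)
      (Continuous.intervalIntegrable (by fun_prop) _ _),
    intervalIntegral.integral_smul_const, intervalIntegral.integral_smul_const]
  rw [intervalIntegral.integral_sub (by simp) (Continuous.intervalIntegrable continuous_id' _ _)]
  norm_num [smul_add]

variable {a b : A} {p : ℝ}

lemma CFC.intervalIntegrable_segment_rpow (ha : 0 ≤ a) (hb : 0 ≤ b) (hp : 0 ≤ p) :
    IntervalIntegrable (fun t : ℝ => (t • a + (1 - t) • b) ^ p) MeasureTheory.volume 0 1 :=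
  ContinuousOn.intervalIntegrable_of_Icc zero_le_one (CFC.continuousOn_segment_rpow ha hb hp)

lemma CFC.intervalIntegral_segment_rpow_nonneg :
    0 ≤ ∫ t in (0 : ℝ)..1, (t • a + (1 - t) • b) ^ p := by
  rw [intervalIntegral.integral_of_le zero_le_one]
  exact MeasureTheory.integral_nonneg fun _ => CFC.rpow_nonneg

/-- The right Hermite–Hadamard inequality for the operator convex function `a ↦ a ^ p`. -/
theorem CFC.intervalIntegral_segment_rpow_le (ha : 0 ≤ a) (hb : 0 ≤ b)
    (hp : p ∈ Set.Icc (1 : ℝ) 2) :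
    ∫ t in (0 : ℝ)..1, (t • a + (1 - t) • b) ^ p ≤ (1 / 2 : ℝ) • (a ^ p + b ^ p) := by
  rw [← intervalIntegral_segment, intervalIntegral.integral_of_le zero_le_one,
    intervalIntegral.integral_of_le zero_le_one]
  refine MeasureTheory.setIntegral_mono_on
    (CFC.intervalIntegrable_segment_rpow ha hb (by linarith [hp.1])).1
    (Continuous.intervalIntegrable (by fun_prop) 0 1).1 measurableSet_Ioc fun t ht => ?_
  exact (CFC.convexOn_rpow hp).2 ha hb ht.1.le (sub_nonneg.2 ht.2) (by ring)

lemma CFC.tangent_le_intervalIntegral_segment_rpow (ha : 0 ≤ a) (hb : 0 ≤ b) (hp : 1 ≤ p)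
    {c : ℝ} (hc : 0 ≤ c) :
    (p * c ^ (p - 1)) • ((1 / 2 : ℝ) • (a + b)) - algebraMap ℝ A ((p - 1) * c ^ p) ≤
      ∫ t in (0 : ℝ)..1, (t • a + (1 - t) • b) ^ p := by
  have heq : (p * c ^ (p - 1)) • ((1 / 2 : ℝ) • (a + b)) - algebraMap ℝ A ((p - 1) * c ^ p)
      = ∫ t in (0 : ℝ)..1, ((p * c ^ (p - 1)) • (t • a + (1 - t) • b)
          - algebraMap ℝ A ((p - 1) * c ^ p)) := by
    rw [intervalIntegral.integral_sub (Continuous.intervalIntegrable (by fun_prop) _ _)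
      (by simp), intervalIntegral.integral_smul, intervalIntegral_segment]
    simp
  rw [heq, intervalIntegral.integral_of_le zero_le_one,
    intervalIntegral.integral_of_le zero_le_one]
  refine MeasureTheory.setIntegral_mono_on
    (Continuous.intervalIntegrable (by fun_prop) 0 1).1
    (CFC.intervalIntegrable_segment_rpow ha hb (by linarith)).1 measurableSet_Ioc fun t ht => ?_
  exact CFC.tangent_le_rpow hp hc (segment_nonneg ha hb ⟨ht.1.le, ht.2⟩)

end Segment

section NumericalRadius

variable {H : Type*} [NormedAddCommGroup H] [InnerProductSpace ℂ H] [CompleteSpace H]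

omit [CompleteSpace H] in
lemma re_inner_real_smul_left (k : ℝ) (y x : H) :
    RCLike.re (inner ℂ (k • y) x) = k * RCLike.re (inner ℂ y x) := by
  rw [inner_smul_left_eq_smul, RCLike.smul_re]

/-- Cauchy–Schwarz on either side of the inner product bounds |⟨x, Tx⟩| by both ‖Tx‖ and ‖T*x‖;
average the squares. -/
lemma norm_inner_self_apply_sq_le (T : H →L[ℂ] H) {x : H} (hx : ‖x‖ = 1) :
    ‖inner ℂ x (T x)‖ ^ 2 ≤
      ((1 / 2 : ℝ) • (star T * T + T * star T)).reApplyInnerSelf x := by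
  have h1 : ‖inner ℂ x (T x)‖ ≤ ‖T x‖ := by
    simpa [hx] using norm_inner_le_norm (𝕜 := ℂ) x (T x)
  have h2 : ‖inner ℂ x (T x)‖ ≤ ‖star T x‖ := by
    rw [ContinuousLinearMap.star_eq_adjoint, ← ContinuousLinearMap.adjoint_inner_left]
    simpa [hx] using norm_inner_le_norm (𝕜 := ℂ) (ContinuousLinearMap.adjoint T x) x
  have heq : ((1 / 2 : ℝ) • (star T * T + T * star T)).reApplyInnerSelf x
      = 1 / 2 * (‖T x‖ ^ 2 + ‖star T x‖ ^ 2) := by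
    have hT : RCLike.re (inner ℂ ((star T * T) x) x) = ‖T x‖ ^ 2 :=
      (ContinuousLinearMap.apply_norm_sq_eq_inner_adjoint_left T x).symm
    have hT' : RCLike.re (inner ℂ ((T * star T) x) x) = ‖star T x‖ ^ 2 := by
      simpa [ContinuousLinearMap.star_eq_adjoint] using
        (ContinuousLinearMap.apply_norm_sq_eq_inner_adjoint_left (star T) x).symm
    rw [ContinuousLinearMap.reApplyInnerSelf_apply, ← hT, ← hT', smul_apply,
      add_apply, re_inner_real_smul_left, inner_add_left, map_add]
  rw [heq]
  nlinarith [norm_nonneg (inner ℂ x (T x))]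

omit [CompleteSpace H] in
lemma reApplyInnerSelf_le_norm (B : H →L[ℂ] H) {x : H} (hx : ‖x‖ = 1) :
    B.reApplyInnerSelf x ≤ ‖B‖ := by
  rw [ContinuousLinearMap.reApplyInnerSelf_apply]
  calc _ ≤ ‖inner ℂ (B x) x‖ := RCLike.re_le_norm _
    _ ≤ ‖B x‖ * ‖x‖ := norm_inner_le_norm _ _
    _ ≤ ‖B‖ := by simpa [hx] using B.le_opNorm x

omit [CompleteSpace H] in
lemma reApplyInnerSelf_mono {B C : H →L[ℂ] H} (h : B ≤ C) (x : H) :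
    B.reApplyInnerSelf x ≤ C.reApplyInnerSelf x := by
  have := ((ContinuousLinearMap.le_def B C).1 h).2 x
  simpa [ContinuousLinearMap.reApplyInnerSelf_apply, inner_sub_left] using this

lemma norm_inner_self_apply_sq_rpow_le (T : H →L[ℂ] H) {x : H} (hx : ‖x‖ = 1) {r : ℝ}
    (hr : 1 ≤ r) :
    (‖inner ℂ x (T x)‖ ^ 2) ^ r ≤
      ‖∫ t in (0 : ℝ)..1, (t • (star T * T) + (1 - t) • (T * star T)) ^ r‖ := by
  set c : ℝ := ‖inner ℂ x (T x)‖ ^ 2 with hc_def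
  have hc : 0 ≤ c := by positivity
  refine le_trans ?_ (reApplyInnerSelf_le_norm _ hx)
  refine le_trans ?_ (reApplyInnerSelf_mono (CFC.tangent_le_intervalIntegral_segment_rpow
    (star_mul_self_nonneg T) (mul_star_self_nonneg T) hr hc) x)
  have hlow := norm_inner_self_apply_sq_le T hx
  rw [← hc_def] at hlow
  have hpow : c * c ^ (r - 1) = c ^ r := by
    rw [mul_comm, ← Real.rpow_add_one' hc (by linarith), sub_add_cancel]
  have heq : ∀ (k m : ℝ) (B : H →L[ℂ] H),
      (k • B - algebraMap ℝ (H →L[ℂ] H) m).reApplyInnerSelf x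
        = k * B.reApplyInnerSelf x - m := by
    intro k m B
    simp only [ContinuousLinearMap.reApplyInnerSelf_apply, Algebra.algebraMap_eq_smul_one,
      sub_apply, smul_apply, one_apply_eq_self, inner_sub_left, map_sub, re_inner_real_smul_left]
    simp [hx]
  rw [heq]
  -- Tangency at c itself makes the bound close up: r c^(r-1) · c - (r - 1) c^r = c^r.
  nlinarith [mul_le_mul_of_nonneg_left hlow
    (mul_nonneg (by linarith : 0 ≤ r) (Real.rpow_nonneg hc (r - 1)))]

end NumericalRadius

theorem corollary2p11 {H : Type*} [NormedAddCommGroup H] [InnerProductSpace ℂ H]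
    [CompleteSpace H] (T : H →L[ℂ] H) (r : ℝ) (hr₁ : 1 ≤ r) (hr₂ : r ≤ 2) :
    IntervalIntegrable
      (fun t : ℝ => (t • (star T * T) + (1 - t) • (T * star T)) ^ r)
      MeasureTheory.volume 0 1 ∧
    numericalRadius T ^ 2 ≤
      ‖∫ t in (0 : ℝ)..1, (t • (star T * T) + (1 - t) • (T * star T)) ^ r‖ ^ (1 / r) ∧
    ‖∫ t in (0 : ℝ)..1, (t • (star T * T) + (1 - t) • (T * star T)) ^ r‖ ^ (1 / r) ≤
      ‖(1 / 2 : ℝ) • ((star T * T) ^ r + (T * star T) ^ r)‖ ^ (1 / r) := by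
  have ha : 0 ≤ star T * T := star_mul_self_nonneg T
  have hb : 0 ≤ T * star T := mul_star_self_nonneg T
  have hr : 0 < r := by linarith
  refine ⟨CFC.intervalIntegrable_segment_rpow ha hb hr.le, ?_, ?_⟩
  · set M := ‖∫ t in (0 : ℝ)..1, (t • (star T * T) + (1 - t) • (T * star T)) ^ r‖
    have hM : 0 ≤ M ^ (1 / r) := by positivity
    rw [← Real.sq_sqrt hM]
    have hw : 0 ≤ numericalRadius T :=
      Real.sSup_nonneg (by rintro _ ⟨x, -, rfl⟩; exact norm_nonneg _)
    -- A nonnegative bound on the supremum also covers the empty set, that is, the zero space.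
    refine pow_le_pow_left₀ hw (Real.sSup_le ?_ (Real.sqrt_nonneg _)) 2
    rintro _ ⟨x, hx, rfl⟩
    refine Real.le_sqrt_of_sq_le ?_
    rw [one_div, Real.le_rpow_inv_iff_of_pos (by positivity) (norm_nonneg _) hr]
    exact norm_inner_self_apply_sq_rpow_le T hx hr₁
  · refine Real.rpow_le_rpow (norm_nonneg _) ?_ (by positivity)
    exact CStarAlgebra.norm_le_norm_of_nonneg_of_le CFC.intervalIntegral_segment_rpow_nonneg
      (CFC.intervalIntegral_segment_rpow_le ha hb ⟨hr₁, hr₂⟩)
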